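/- Let $n\ge 1$ and let $B_n=\{x\in\mathbb R^n:\|x\|\le 1\}$ be the closed Euclidean unit ball. For a nondegenerate simplex $S\subset B_n$ with vertices $x^{(1)},\dots,x^{(n+1)}$, let $P_S$ be the interpolation projector on $C(B_n)$ which sends $f$ to the polynomial $P_Sf$ of degree at most $1$ with $P_Sf(x^{(j)})=f(x^{(j)})$ for $j=1,\dots,n+1$, let $\|P_S\|_{B_n}$ be its norm as an operator from $C(B_n)$ to $C(B_n)$ with the uniform norm, and let $\theta_n(B_n)$ be the minimal value of $\|P_S\|_{B_n}$ over all such simplices $S$. Let $$\chi_n(t)=\frac{1}{2^n n!}\,\frac{d^n}{dt^n}(t^2-1)^n$$ be the standardized Legendre polynomial of degree $n$, and let $\chi_n^{-1}$ be the function inverse to $\chi_n$ on $[1,+\infty)$. Then, for every $n\ge 1$, the following right-hand side is well defined and $$\theta_n(B_n)\ \ge\ \chi_n^{-1}\left(\frac{\pi^{n/2}\,n!}{\Gamma(n/2+1)\,\sqrt{n+1}\,\left(\frac{n+1}{n}\right)^{n/2}}\right).$$ If $n=2k$ with $k\ge 1$, this inequality is equivalent to $$\theta_{2k}(B_{2k})\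 \ge\ \chi_{2k}^{-1}\left(\frac{\pi^{k}\,(2k)!}{k!\,\sqrt{2k+1}\,\left(\frac{2k+1}{2k}\right)^{k}}\right),$$ which therefore holds; and if $n=2k+1$ with $k\ge 0$, then $$\theta_{2k+1}(B_{2k+1})\ \ge\ \chi_{2k+1}^{-1}\left(\frac{2\,(k!)\,(4\pi)^{k}}{\sqrt{2k+2}\,\left(\frac{2k+2}{2k+1}\right)^{(2k+1)/2}}\right).$$ Here too the arguments of $\chi_{2k}^{-1}$ and $\chi_{2k+1}^{-1}$ lie in the domains of these functions. -/

import Mathlib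

open Polynomial in
/-- The standardized Legendre polynomial of degree `n`, given by Rodrigues' formula
`(1 / (2 ^ n * n!)) * (d / dt) ^ n (t ^ 2 - 1) ^ n`. -/
noncomputable def legendrePoly (n : ℕ) : ℝ[X] :=
  C (1 / (2 ^ n * (n.factorial : ℝ))) * derivative^[n] ((X ^ 2 - 1) ^ n)

/-- The Legendre polynomial as a function of a real variable. -/
noncomputable def chi (n : ℕ) (t : ℝ) : ℝ := (legendrePoly n).eval t

/-- The function inverse to `chi n` on the semi-axis `[1, ∞)`. -/
noncomputable def chiInv (n : ℕ) : ℝ → ℝ := Function.invFunOn (chi n) (Set.Ici 1)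

/-- `P : C(K) → C(K)` is the interpolation projector onto the polynomials of degree at most one
(that is, the affine functions on `ℝⁿ`) whose nodes are the vertices of the nondegenerate
simplex `S`, all of which lie in `K`. -/
structure IsInterpolationProjector {n : ℕ} (K : Set (EuclideanSpace ℝ (Fin n)))
    [CompactSpace K] (S : Affine.Simplex ℝ (EuclideanSpace ℝ (Fin n)) n)
    (P : C(K, ℝ) →L[ℝ] C(K, ℝ)) : Prop where
  nodes_mem : ∀ j, S.points j ∈ K
  affine : ∀ f : C(K, ℝ), ∃ p : EuclideanSpace ℝ (Fin n) →ᵃ[ℝ] ℝ, ∀ x : K, P f x = p x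
  interpolates : ∀ (f : C(K, ℝ)) (j : Fin (n + 1)),
    P f ⟨S.points j, nodes_mem j⟩ = f ⟨S.points j, nodes_mem j⟩

/-- The minimal operator norm on `C(K)` (with the uniform norm) of an interpolation projector
with nodes in `K`. -/
noncomputable def theta (n : ℕ) (K : Set (EuclideanSpace ℝ (Fin n))) [CompactSpace K] : ℝ :=
  sInf {r : ℝ | ∃ (S : Affine.Simplex ℝ (EuclideanSpace ℝ (Fin n)) n)
    (P : C(K, ℝ) →L[ℝ] C(K, ℝ)), IsInterpolationProjector K S P ∧ r = ‖P‖}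

/-- The closed Euclidean unit ball of `ℝⁿ`. -/
abbrev unitBall (n : ℕ) : Set (EuclideanSpace ℝ (Fin n)) := Metric.closedBall 0 1

/-- The argument of the inverse Legendre polynomial in the lower bound for the ball. -/
noncomputable def ballRatio (n : ℕ) : ℝ :=
  Real.pi ^ ((n : ℝ) / 2) * (n.factorial : ℝ) /
    (Real.Gamma ((n : ℝ) / 2 + 1) * √((n : ℝ) + 1) * (((n : ℝ) + 1) / (n : ℝ)) ^ ((n : ℝ) / 2))

/-- The explicit form of this argument in the even dimension `2 * k`. -/
noncomputable def ballRatioEven (k : ℕ) : ℝ :=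
  Real.pi ^ k * ((2 * k).factorial : ℝ) /
    ((k.factorial : ℝ) * √(2 * (k : ℝ) + 1) * ((2 * (k : ℝ) + 1) / (2 * (k : ℝ))) ^ k)

/-- The explicit form of this argument in the odd dimension `2 * k + 1`. -/
noncomputable def ballRatioOdd (k : ℕ) : ℝ :=
  2 * (k.factorial : ℝ) * (4 * Real.pi) ^ k /
    (√(2 * (k : ℝ) + 2) *
      ((2 * (k : ℝ) + 2) / (2 * (k : ℝ) + 1)) ^ ((2 * (k : ℝ) + 1) / 2))

open MeasureTheory

/-! Let `c = ‖P‖`. Testing `P` on a function of norm at most 1 whose values at the nodes are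
prescribed signs shows that the barycentric coordinates of every point of the ball satisfy `∑ |λ i|
≤ c` (`sum_abs_coord_le_norm`). Since `∑ λ i = 1`, their positive and negative parts sum to at most
`(c + 1) / 2` and `(c - 1) / 2`. Counting orthants by sign pattern, the region so defined in `ℝⁿ`
has volume `χ_n(c) / n!`, by the Leibniz expansion of Rodrigues' formula. An affine map with
determinant that of the edge matrix carries this region onto a set containing the ball, so `vol(B_n)
≤ |det| χ_n(c) / n!`. Hadamard's inequality bounds the determinant for vertices in the ball, giving
`ballRatio n ≤ χ_n(c)`; monotonicity of `χ_n` on `[1, ∞)` then inverts this. -/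

/-! ### Legendre polynomials on `[1, ∞)`. -/

/-- Leibniz's rule applied to `(t - 1) ^ n * (t + 1) ^ n`. For `t ≥ 1` every term is nonnegative and
nondecreasing. -/
theorem chi_eq_sum (n : ℕ) (t : ℝ) :
    chi n t = ∑ k ∈ Finset.range (n + 1),
      (n.choose k : ℝ) ^ 2 * (((t - 1) / 2) ^ k * ((t + 1) / 2) ^ (n - k)) := by
  have h : ((Polynomial.X : Polynomial ℝ) ^ 2 - 1) ^ n
      = (Polynomial.X - Polynomial.C 1) ^ n * (Polynomial.X + Polynomial.C 1) ^ n := by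
    rw [← mul_pow, map_one]
    ring
  rw [chi, legendrePoly, h, Polynomial.iterate_derivative_mul, Polynomial.eval_mul,
    Polynomial.eval_C, Polynomial.eval_finsetSum, Finset.mul_sum]
  refine Finset.sum_congr rfl fun k hk => ?_
  have hk' : k ≤ n := Nat.lt_succ_iff.mp (Finset.mem_range.mp hk)
  obtain ⟨m, rfl⟩ := Nat.exists_eq_add_of_le hk'
  rw [Polynomial.iterate_derivative_X_sub_pow, Polynomial.iterate_derivative_X_add_pow,
    Nat.sub_sub_self hk', Nat.add_sub_cancel_left]
  have h1 : ((k + m).descFactorial m : ℝ) = ((k + m).choose k : ℝ) * m.factorial := by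
    have h3 := Nat.descFactorial_eq_factorial_mul_choose (k + m) m
    rw [Nat.choose_symm_add, h3, Nat.cast_mul, mul_comm]
  have h2 : ((k + m).descFactorial k : ℝ) = ((k + m).choose k : ℝ) * k.factorial := by
    have h3 := Nat.descFactorial_eq_factorial_mul_choose (k + m) k
    rw [h3, Nat.cast_mul, mul_comm]
  have h3 : (((k + m).factorial : ℕ) : ℝ)
      = ((k + m).choose k : ℝ) * k.factorial * m.factorial := by
    have h4 := Nat.choose_mul_factorial_mul_factorial hk'
    rw [Nat.add_sub_cancel_left] at h4
    exact_mod_cast h4.symm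
  have hk0 : (k.factorial : ℝ) ≠ 0 := by positivity
  have hm0 : (m.factorial : ℝ) ≠ 0 := by positivity
  have hc0 : ((k + m).choose k : ℝ) ≠ 0 := by
    exact_mod_cast (Nat.choose_pos hk').ne'
  simp only [nsmul_eq_mul, Polynomial.eval_mul, Polynomial.eval_natCast, Polynomial.eval_pow,
    Polynomial.eval_sub, Polynomial.eval_add, Polynomial.eval_X, Polynomial.eval_C, h1, h2, h3,
    div_pow]
  field_simp
  ring

theorem chi_one (n : ℕ) : chi n 1 = 1 := by
  rw [chi_eq_sum, Finset.sum_range_succ']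
  norm_num

theorem strictMonoOn_chi {n : ℕ} (hn : 1 ≤ n) : StrictMonoOn (chi n) (Set.Ici 1) := by
  intro s hs t ht hst
  rw [Set.mem_Ici] at hs ht
  rw [chi_eq_sum, chi_eq_sum]
  refine Finset.sum_lt_sum (fun k _ => ?_) ⟨0, by simp, ?_⟩
  · have : 0 ≤ (s - 1) / 2 := by linarith
    have : 0 ≤ (t - 1) / 2 := by linarith
    gcongr
  · simp only [Nat.choose_zero_right, Nat.cast_one, one_pow, pow_zero, one_mul, Nat.sub_zero]
    gcongr

theorem continuous_chi (n : ℕ) : Continuous (chi n) :=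
  (legendrePoly n).continuous

theorem le_chi {n : ℕ} (hn : 1 ≤ n) {t : ℝ} (ht : 1 ≤ t) : (t + 1) / 2 ≤ chi n t := by
  rw [chi_eq_sum]
  have h0 : ∀ k ∈ Finset.range (n + 1),
      0 ≤ (n.choose k : ℝ) ^ 2 * (((t - 1) / 2) ^ k * ((t + 1) / 2) ^ (n - k)) := by
    intro k _
    have : 0 ≤ (t - 1) / 2 := by linarith
    positivity
  refine le_trans ?_ (Finset.single_le_sum h0 (a := 0) (by simp))
  simpa using le_self_pow₀ (by linarith : 1 ≤ (t + 1) / 2) (by omega : n ≠ 0)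

theorem mem_chi_image {n : ℕ} (hn : 1 ≤ n) {r : ℝ} (hr : 1 ≤ r) : r ∈ chi n '' Set.Ici 1 := by
  -- The endpoint `2 * r` suffices because `le_chi` gives `χ_n(2r) ≥ r + 1/2`.
  have h := intermediate_value_Icc (by linarith : (1 : ℝ) ≤ 2 * r) (continuous_chi n).continuousOn
  have h2 := le_chi hn (by linarith : (1 : ℝ) ≤ 2 * r)
  obtain ⟨t, ht, htr⟩ := h ⟨(chi_one n).trans_le hr, by linarith⟩
  exact ⟨t, ht.1, htr⟩

theorem chiInv_le {n : ℕ} (hn : 1 ≤ n) {r t : ℝ} (hr : 1 ≤ r) (ht : 1 ≤ t) (h : r ≤ chi n t) :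
    chiInv n r ≤ t := by
  have hm := mem_chi_image hn hr
  refine ((strictMonoOn_chi hn).le_iff_le (Function.invFunOn_mem hm) ht).1 ?_
  rwa [Function.invFunOn_eq hm]

/-! ### Volume of the region with bounded positive and negative parts. -/

/-- The volume of the set of points of `ℝⁿ` whose positive part and negative part have coordinate
sums at most `a` and `b`. -/
noncomputable def orthantVolume (n : ℕ) (a b : ℝ) : ℝ :=
  ∑ k ∈ Finset.range (n + 1),
    (n.choose k : ℝ) * (b ^ k / k.factorial * (a ^ (n - k) / (n - k).factorial))

theorem chi_eq_factorial_mul_orthantVolume (n : ℕ) (t : ℝ) :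
    chi n t = n.factorial * orthantVolume n ((t + 1) / 2) ((t - 1) / 2) := by
  rw [chi_eq_sum, orthantVolume, Finset.mul_sum]
  refine Finset.sum_congr rfl fun k hk => ?_
  have hk' : k ≤ n := Nat.lt_succ_iff.mp (Finset.mem_range.mp hk)
  rw [← Nat.choose_mul_factorial_mul_factorial hk']
  push_cast
  field_simp

theorem orthantVolume_nonneg (n : ℕ) {a b : ℝ} (ha : 0 ≤ a) (hb : 0 ≤ b) :
    0 ≤ orthantVolume n a b :=
  Finset.sum_nonneg fun _ _ => by positivity

theorem continuous_orthantVolume_left (n : ℕ) (b : ℝ) :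
    Continuous fun a => orthantVolume n a b := by
  unfold orthantVolume
  fun_prop

theorem continuous_orthantVolume_right (n : ℕ) (a : ℝ) :
    Continuous fun b => orthantVolume n a b := by
  unfold orthantVolume
  fun_prop

theorem integral_pow_div_factorial (k : ℕ) (a : ℝ) :
    ∫ t in (0 : ℝ)..a, t ^ k / k.factorial = a ^ (k + 1) / (k + 1).factorial := by
  rw [intervalIntegral.integral_div, integral_pow, Nat.factorial_succ]
  push_cast
  field_simp
  simp

/-- Pascal's rule, in the form produced by slicing along one coordinate. -/
theorem orthantVolume_succ (n : ℕ) (a b : ℝ) :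
    orthantVolume (n + 1) a b =
      (∫ t in (0 : ℝ)..a, orthantVolume n t b) + ∫ t in (0 : ℝ)..b, orthantVolume n a t := by
  have h := Finset.sum_choose_succ_mul
    (fun i j : ℕ => b ^ i / (i.factorial : ℝ) * (a ^ j / j.factorial)) n
  unfold orthantVolume
  rw [h, intervalIntegral.integral_finsetSum, intervalIntegral.integral_finsetSum]
  · congr 1
    · refine Finset.sum_congr rfl fun k hk => ?_
      have hk' : k ≤ n := Nat.lt_succ_iff.mp (Finset.mem_range.mp hk)
      rw [intervalIntegral.integral_const_mul, intervalIntegral.integral_const_mul,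
        integral_pow_div_factorial, Nat.sub_add_comm hk']
    · refine Finset.sum_congr rfl fun k hk => ?_
      rw [intervalIntegral.integral_const_mul, intervalIntegral.integral_mul_const,
        integral_pow_div_factorial]
  · intro k _
    exact Continuous.intervalIntegrable (by fun_prop) _ _
  · intro k _
    exact Continuous.intervalIntegrable (by fun_prop) _ _

/-- The points of `ℝⁿ` whose positive part and negative part have coordinate sums at most
`a` and `b`. -/
def orthantSet (n : ℕ) (a b : ℝ) : Set (Fin n → ℝ) :=
  {x | ∑ i, max (x i) 0 ≤ a ∧ ∑ i, max (-x i) 0 ≤ b}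

theorem measurableSet_orthantSet (n : ℕ) (a b : ℝ) : MeasurableSet (orthantSet n a b) := by
  have h1 : Continuous fun x : Fin n → ℝ => ∑ i, max (x i) 0 := by fun_prop
  have h2 : Continuous fun x : Fin n → ℝ => ∑ i, max (-x i) 0 := by fun_prop
  exact ((isClosed_le h1 continuous_const).inter (isClosed_le h2 continuous_const)).measurableSet

/-- Fubini in the first coordinate `t`: a slice with `t ≥ 0` spends `t` of the budget `a`, one with
`t < 0` spends `-t` of `b`. -/
theorem volume_orthantSet_le (n : ℕ) : ∀ {a b : ℝ}, 0 ≤ a → 0 ≤ b →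
    volume (orthantSet n a b) ≤ ENNReal.ofReal (orthantVolume n a b) := by
  induction n with
  | zero =>
    intro a b ha hb
    refine (measure_mono (Set.subset_univ _)).trans ?_
    simp [orthantVolume, volume_pi]
  | succ n ih =>
    intro a b ha hb
    let e := MeasurableEquiv.piFinSuccAbove (fun _ : Fin (n + 1) => ℝ) 0
    have he := volume_preserving_piFinSuccAbove (fun _ : Fin (n + 1) => ℝ) 0
    have hT : MeasurableSet (e.symm ⁻¹' orthantSet (n + 1) a b) :=
      e.symm.measurable (measurableSet_orthantSet _ _ _)
    have hmem : ∀ (t : ℝ) (y : Fin n → ℝ), (t, y) ∈ e.symm ⁻¹' orthantSet (n + 1) a b ↔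
        max t 0 + ∑ i, max (y i) 0 ≤ a ∧ max (-t) 0 + ∑ i, max (-y i) 0 ≤ b := by
      intro t y
      simp [e, orthantSet, Fin.sum_univ_succ, MeasurableEquiv.piFinSuccAbove]
    have hn1 : ∀ y : Fin n → ℝ, 0 ≤ ∑ i, max (y i) 0 := fun y =>
      Finset.sum_nonneg fun i _ => le_max_right _ _
    have hn2 : ∀ y : Fin n → ℝ, 0 ≤ ∑ i, max (-y i) 0 := fun y =>
      Finset.sum_nonneg fun i _ => le_max_right _ _
    have hpre : orthantSet (n + 1) a b = e ⁻¹' (e.symm ⁻¹' orthantSet (n + 1) a b) := by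
      ext x
      simp
    -- Both indicators may count `t = 0`, which is harmless for an upper bound.
    let g : ℝ → ENNReal := fun t =>
      (Set.Icc 0 a).indicator (fun t => ENNReal.ofReal (orthantVolume n (a - t) b)) t +
      (Set.Icc (-b) 0).indicator (fun t => ENNReal.ofReal (orthantVolume n a (b + t))) t
    have hslice : ∀ t, volume (Prod.mk t ⁻¹' (e.symm ⁻¹' orthantSet (n + 1) a b)) ≤ g t := by
      intro t
      rcases le_or_gt 0 t with ht | ht
      · by_cases hta : t ≤ a
        · have hsub : Prod.mk t ⁻¹' (e.symm ⁻¹' orthantSet (n + 1) a b)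
              ⊆ orthantSet n (a - t) b := by
            intro y hy
            have h1 := (hmem t y).1 hy
            rw [max_eq_left ht, max_eq_right (by linarith : -t ≤ 0)] at h1
            exact ⟨by linarith [h1.1], by linarith [h1.2]⟩
          refine (measure_mono hsub).trans ((ih (by linarith) hb).trans ?_)
          have : t ∈ Set.Icc 0 a := ⟨ht, hta⟩
          simp only [g, Set.indicator_of_mem this]
          exact le_self_add
        · have hemp : Prod.mk t ⁻¹' (e.symm ⁻¹' orthantSet (n + 1) a b) = ∅ := by
            refine Set.eq_empty_of_forall_notMem fun y hy => hta ?_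
            have h1 := ((hmem t y).1 hy).1
            rw [max_eq_left ht] at h1
            linarith [hn1 y]
          simp [hemp]
      · by_cases htb : -b ≤ t
        · have hsub : Prod.mk t ⁻¹' (e.symm ⁻¹' orthantSet (n + 1) a b)
              ⊆ orthantSet n a (b + t) := by
            intro y hy
            have h1 := (hmem t y).1 hy
            rw [max_eq_right ht.le, max_eq_left (by linarith : 0 ≤ -t)] at h1
            exact ⟨by linarith [h1.1], by linarith [h1.2]⟩
          refine (measure_mono hsub).trans ((ih ha (by linarith)).trans ?_)
          have : t ∈ Set.Icc (-b) 0 := ⟨htb, ht.le⟩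
          simp only [g, Set.indicator_of_mem this]
          exact le_add_self
        · have hemp : Prod.mk t ⁻¹' (e.symm ⁻¹' orthantSet (n + 1) a b) = ∅ := by
            refine Set.eq_empty_of_forall_notMem fun y hy => htb ?_
            have h1 := ((hmem t y).1 hy).2
            rw [max_eq_left (by linarith : 0 ≤ -t)] at h1
            linarith [hn2 y]
          simp [hemp]
    have hc1 : Continuous fun t => orthantVolume n (a - t) b :=
      (continuous_orthantVolume_left n b).comp (continuous_const.sub continuous_id)
    have hc2 : Continuous fun t => orthantVolume n a (b + t) :=
      (continuous_orthantVolume_right n a).comp (continuous_const.add continuous_id)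
    have hi1 : ∫⁻ t in Set.Icc 0 a, ENNReal.ofReal (orthantVolume n (a - t) b)
        = ENNReal.ofReal (∫ t in (0 : ℝ)..a, orthantVolume n t b) := by
      rw [← ofReal_integral_eq_lintegral_ofReal, integral_Icc_eq_integral_Ioc,
        ← intervalIntegral.integral_of_le ha,
        intervalIntegral.integral_comp_sub_left (fun t => orthantVolume n t b) a]
      · simp
      · exact hc1.continuousOn.integrableOn_compact isCompact_Icc
      · filter_upwards [ae_restrict_mem measurableSet_Icc] with t ht
        exact orthantVolume_nonneg n (by linarith [ht.2]) hb
    have hi2 : ∫⁻ t in Set.Icc (-b) 0, ENNReal.ofReal (orthantVolume n a (b + t))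
        = ENNReal.ofReal (∫ t in (0 : ℝ)..b, orthantVolume n a t) := by
      rw [← ofReal_integral_eq_lintegral_ofReal, integral_Icc_eq_integral_Ioc,
        ← intervalIntegral.integral_of_le (by linarith),
        intervalIntegral.integral_comp_add_left (fun t => orthantVolume n a t) b]
      · simp
      · exact hc2.continuousOn.integrableOn_compact isCompact_Icc
      · filter_upwards [ae_restrict_mem measurableSet_Icc] with t ht
        exact orthantVolume_nonneg n ha (by linarith [ht.1])
    calc volume (orthantSet (n + 1) a b)
        = volume (e.symm ⁻¹' orthantSet (n + 1) a b) := by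
          conv_lhs => rw [hpre]
          exact he.measure_preimage hT.nullMeasurableSet
      _ = ∫⁻ t, volume (Prod.mk t ⁻¹' (e.symm ⁻¹' orthantSet (n + 1) a b)) := by
          rw [Measure.volume_eq_prod, Measure.prod_apply hT]
      _ ≤ ∫⁻ t, g t := lintegral_mono hslice
      _ = _ := by
          simp only [g]
          rw [lintegral_add_left, lintegral_indicator measurableSet_Icc,
            lintegral_indicator measurableSet_Icc, hi1, hi2, ← ENNReal.ofReal_add,
            ← orthantVolume_succ]
          · exact intervalIntegral.integral_nonneg ha fun t ht => orthantVolume_nonneg n ht.1 hb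
          · exact intervalIntegral.integral_nonneg hb fun t ht => orthantVolume_nonneg n ha ht.1
          · exact Measurable.indicator hc1.measurable.ennreal_ofReal measurableSet_Icc

/-! ### Determinant bound for a simplex in the unit ball. -/

/-- Hadamard's determinant inequality for the rows of a real matrix. -/
theorem abs_det_le_prod_norm_row {n : ℕ} (M : Matrix (Fin n) (Fin n) ℝ) :
    |M.det| ≤ ∏ i, ‖WithLp.toLp 2 (M i)‖ := by
  have : Fact (Module.finrank ℝ (EuclideanSpace ℝ (Fin n)) = n) := ⟨finrank_euclideanSpace_fin⟩
  let b := EuclideanSpace.basisFun (Fin n) ℝ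
  let o := b.toBasis.orientation
  have h := o.abs_volumeForm_apply_le fun i => WithLp.toLp 2 (M i)
  rw [o.volumeForm_robust' b, Module.Basis.det_apply] at h
  have hM : b.toBasis.toMatrix (fun i => WithLp.toLp 2 (M i)) = M.transpose := by
    ext i j
    simp [b, Module.Basis.toMatrix_apply]
  rwa [hM, Matrix.det_transpose] at h

/-- The matrix whose rows are the edges from vertex `0`. -/
def edgeMatrix {n : ℕ} (x : Fin (n + 1) → EuclideanSpace ℝ (Fin n)) : Matrix (Fin n) (Fin n) ℝ :=
  Matrix.of fun i j => x i.succ j - x 0 j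

theorem det_cons_column {n : ℕ} (x : Fin (n + 1) → EuclideanSpace ℝ (Fin n)) (c : ℝ) :
    (Matrix.of fun i : Fin (n + 1) => (Fin.cons c (x i) : Fin (n + 1) → ℝ)).det
      = c * (edgeMatrix x).det := by
  let A : Matrix (Fin (n + 1)) (Fin (n + 1)) ℝ :=
    Matrix.of (Fin.cons (Fin.cons c (x 0)) fun i => Fin.cons 0 fun j => x i.succ j - x 0 j)
  have h : A.det = (Matrix.of fun i : Fin (n + 1) => (Fin.cons c (x i) : Fin (n + 1) → ℝ)).det := by
    refine Matrix.det_eq_of_forall_row_eq_smul_add_const (Fin.cons 0 fun _ => -1) 0 rfl ?_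
    intro i j
    refine Fin.cases ?_ (fun i => ?_) i <;> refine Fin.cases ?_ (fun j => ?_) j <;> simp [A]
    ring
  rw [← h, Matrix.det_succ_column_zero, Fin.sum_univ_succ, Finset.sum_eq_zero]
  · have hs : A.submatrix (Fin.succAbove 0) Fin.succ = edgeMatrix x := by
      ext i j
      simp [A, edgeMatrix]
    rw [hs]
    simp [A]
  · intro i _
    simp [A]

/-- Hadamard is applied to the vertex matrix bordered by a constant column `c`. The choice `c = 1 /
√n` minimizes the resulting bound `(1 + c²) ^ ((n + 1) / 2) / c`. -/
theorem abs_det_edgeMatrix_le {n : ℕ} (hn : 1 ≤ n) {x : Fin (n + 1) → EuclideanSpace ℝ (Fin n)}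
    (hx : ∀ i, ‖x i‖ ≤ 1) :
    |(edgeMatrix x).det| ≤ √((n : ℝ) + 1) * (((n : ℝ) + 1) / n) ^ ((n : ℝ) / 2) := by
  have hn0 : (0 : ℝ) < n := by exact_mod_cast hn
  have h := abs_det_le_prod_norm_row
    (Matrix.of fun i : Fin (n + 1) => (Fin.cons (√n)⁻¹ (x i) : Fin (n + 1) → ℝ))
  rw [det_cons_column, abs_mul, abs_of_pos (by positivity : 0 < (√(n : ℝ))⁻¹)] at h
  have hrow : ∀ i, ‖WithLp.toLp 2 ((Matrix.of fun i : Fin (n + 1) =>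
      (Fin.cons (√n)⁻¹ (x i) : Fin (n + 1) → ℝ)) i)‖ ≤ √(((n : ℝ) + 1) / n) := by
    intro i
    rw [EuclideanSpace.norm_eq, Fin.sum_univ_succ]
    refine Real.sqrt_le_sqrt ?_
    have h1 := hx i
    rw [EuclideanSpace.norm_eq, Real.sqrt_le_iff, one_pow] at h1
    simp only [Matrix.of_apply, Fin.cons_zero, Fin.cons_succ]
    have h2 : ‖(√(n : ℝ))⁻¹‖ ^ 2 = 1 / n := by
      rw [Real.norm_eq_abs, sq_abs, inv_pow, Real.sq_sqrt hn0.le, one_div]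
    rw [h2, add_div, div_self hn0.ne']
    linarith [h1.2]
  have h2 := h.trans (Finset.prod_le_prod (fun i _ => norm_nonneg _) fun i _ => hrow i)
  rw [Finset.prod_const, Finset.card_univ, Fintype.card_fin, inv_mul_le_iff₀ (by positivity)] at h2
  refine h2.trans_eq ?_
  rw [pow_succ', ← mul_assoc, ← Real.sqrt_mul hn0.le, mul_div_cancel₀ _ hn0.ne',
    Real.sqrt_eq_rpow (((n : ℝ) + 1) / n), ← Real.rpow_natCast, ← Real.rpow_mul (by positivity)]
  congr 2
  ring

/-! ### Barycentric coordinates and the projector norm. -/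

/-- The affine basis formed by the vertices of a full-dimensional simplex. -/
noncomputable def simplexBasis {n : ℕ} (S : Affine.Simplex ℝ (EuclideanSpace ℝ (Fin n)) n) :
    AffineBasis (Fin (n + 1)) ℝ (EuclideanSpace ℝ (Fin n)) :=
  ⟨S.points, S.independent, S.span_eq_top finrank_euclideanSpace_fin⟩

theorem simplexBasis_apply {n : ℕ} (S : Affine.Simplex ℝ (EuclideanSpace ℝ (Fin n)) n)
    (i : Fin (n + 1)) : simplexBasis S i = S.points i := rfl

theorem simplexBasis_coord_points {n : ℕ} (S : Affine.Simplex ℝ (EuclideanSpace ℝ (Fin n)) n)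
    (i j : Fin (n + 1)) : (simplexBasis S).coord i (S.points j) = if i = j then 1 else 0 := by
  rw [← simplexBasis_apply, AffineBasis.coord_apply]

theorem affineMap_eq_sum_coord {n : ℕ} (S : Affine.Simplex ℝ (EuclideanSpace ℝ (Fin n)) n)
    (p : EuclideanSpace ℝ (Fin n) →ᵃ[ℝ] ℝ) (x : EuclideanSpace ℝ (Fin n)) :
    p x = ∑ i, (simplexBasis S).coord i x * p (S.points i) := by
  have h1 : ∑ i, (simplexBasis S).coord i x = 1 := (simplexBasis S).sum_coord_apply_eq_one x
  conv_lhs => rw [← (simplexBasis S).affineCombination_coord_eq_self x]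
  rw [Finset.map_affineCombination _ _ _ h1,
    Finset.affineCombination_eq_linear_combination _ _ _ h1]
  simp [simplexBasis_apply]

theorem sum_abs_coord_le_norm {n : ℕ} {K : Set (EuclideanSpace ℝ (Fin n))} [CompactSpace K]
    {S : Affine.Simplex ℝ (EuclideanSpace ℝ (Fin n)) n} {P : C(K, ℝ) →L[ℝ] C(K, ℝ)}
    (hP : IsInterpolationProjector K S P) (x : K) :
    ∑ i, |(simplexBasis S).coord i x| ≤ ‖P‖ := by
  let s : Fin (n + 1) → ℝ := fun i => SignType.sign ((simplexBasis S).coord i x)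
  have hs : ∀ i, -1 ≤ s i ∧ s i ≤ 1 := by
    intro i
    simp only [s]
    rcases SignType.trichotomy (SignType.sign ((simplexBasis S).coord i x)) with h | h | h <;>
      simp [h]
  have hc : ∀ i, Continuous ((simplexBasis S).coord i) := fun i =>
    AffineMap.continuous_of_finiteDimensional _
  -- The affine function with values `s i` at the nodes, clamped to `[-1, 1]`; clamping changes
  -- nothing at the nodes.
  let f : C(K, ℝ) :=
    ⟨fun y => max (-1) (min 1 (∑ i, s i * (simplexBasis S).coord i y)), by
      have : ∀ i, Continuous fun y : K => (simplexBasis S).coord i y := fun i =>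
        (hc i).comp continuous_subtype_val
      fun_prop⟩
  have hf : ‖f‖ ≤ 1 := by
    refine (ContinuousMap.norm_le _ zero_le_one).2 fun y => ?_
    exact abs_le.2 ⟨le_max_left _ _, max_le (by norm_num) (min_le_left _ _)⟩
  have hfs : ∀ j, f ⟨S.points j, hP.nodes_mem j⟩ = s j := by
    intro j
    simp only [f, ContinuousMap.coe_mk, simplexBasis_coord_points]
    simp [(hs j).1, (hs j).2]
  obtain ⟨p, hp⟩ := hP.affine f
  calc ∑ i, |(simplexBasis S).coord i x|
      = ∑ i, (simplexBasis S).coord i x * p (S.points i) := by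
        refine Finset.sum_congr rfl fun i _ => ?_
        rw [← hp ⟨S.points i, hP.nodes_mem i⟩, hP.interpolates, hfs]
        exact (self_mul_sign _).symm
    _ = P f x := by rw [hp, ← affineMap_eq_sum_coord]
    _ ≤ ‖P f‖ := (le_abs_self _).trans ((P f).norm_coe_le_norm x)
    _ ≤ ‖P‖ * ‖f‖ := P.le_opNorm f
    _ ≤ ‖P‖ := mul_le_of_le_one_right P.opNorm_nonneg hf

theorem one_le_norm_of_isInterpolationProjector {n : ℕ} {K : Set (EuclideanSpace ℝ (Fin n))}
    [CompactSpace K] {S : Affine.Simplex ℝ (EuclideanSpace ℝ (Fin n)) n}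
    {P : C(K, ℝ) →L[ℝ] C(K, ℝ)} (hP : IsInterpolationProjector K S P) : 1 ≤ ‖P‖ := by
  refine le_trans ?_ (sum_abs_coord_le_norm hP ⟨S.points 0, hP.nodes_mem 0⟩)
  rw [← (simplexBasis S).sum_coord_apply_eq_one (S.points 0)]
  exact Finset.sum_le_sum fun i _ => le_abs_self _

theorem coord_mem_orthantSet {n : ℕ} (S : Affine.Simplex ℝ (EuclideanSpace ℝ (Fin n)) n)
    {x : EuclideanSpace ℝ (Fin n)} {c : ℝ} (h : ∑ i, |(simplexBasis S).coord i x| ≤ c) :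
    (fun i : Fin n => (simplexBasis S).coord i.succ x) ∈
      orthantSet n ((c + 1) / 2) ((c - 1) / 2) := by
  have h1 : ∑ i, (simplexBasis S).coord i x = 1 := (simplexBasis S).sum_coord_apply_eq_one x
  have hp : ∑ i, max ((simplexBasis S).coord i x) 0
      = (∑ i, |(simplexBasis S).coord i x| + ∑ i, (simplexBasis S).coord i x) / 2 := by
    rw [← Finset.sum_add_distrib, Finset.sum_div]
    refine Finset.sum_congr rfl fun i _ => ?_
    rcases abs_cases ((simplexBasis S).coord i x) with ⟨h, h'⟩ | ⟨h, h'⟩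
    · rw [h, max_eq_left h']
      ring
    · rw [h, max_eq_right h'.le]
      ring
  have hm : ∑ i, max (-(simplexBasis S).coord i x) 0
      = (∑ i, |(simplexBasis S).coord i x| - ∑ i, (simplexBasis S).coord i x) / 2 := by
    rw [← Finset.sum_sub_distrib, Finset.sum_div]
    refine Finset.sum_congr rfl fun i _ => ?_
    rcases abs_cases ((simplexBasis S).coord i x) with ⟨h, h'⟩ | ⟨h, h'⟩
    · rw [h, max_eq_right (by linarith)]
      ring
    · rw [h, max_eq_left (by linarith)]
      ring
  rw [Fin.sum_univ_succ, Fin.sum_univ_succ (fun i => |(simplexBasis S).coord i x|)] at hp hm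
  rw [Fin.sum_univ_succ] at h
  have h0 := le_max_right ((simplexBasis S).coord 0 x) 0
  have h0' := le_max_right (-(simplexBasis S).coord 0 x) 0
  exact ⟨by linarith, by linarith⟩

/-! ### Comparison of volumes. -/

theorem sub_eq_edgeMatrix_mulVec {n : ℕ} (S : Affine.Simplex ℝ (EuclideanSpace ℝ (Fin n)) n)
    (x : EuclideanSpace ℝ (Fin n)) (j : Fin n) :
    (edgeMatrix S.points).transpose.mulVec (fun i => (simplexBasis S).coord i.succ x) j
      = x j - S.points 0 j := by
  have h1 : ∑ i, (simplexBasis S).coord i x = 1 := (simplexBasis S).sum_coord_apply_eq_one x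
  have h := affineMap_eq_sum_coord S
    (EuclideanSpace.projₗ j : EuclideanSpace ℝ (Fin n) →ₗ[ℝ] ℝ).toAffineMap x
  simp only [LinearMap.coe_toAffineMap, PiLp.projₗ_apply] at h
  rw [Fin.sum_univ_succ] at h h1
  rw [h, eq_sub_of_add_eq h1]
  simp only [Matrix.mulVec, dotProduct, edgeMatrix, Matrix.transpose_apply, Matrix.of_apply,
    sub_mul, mul_comm, mul_sub, Finset.sum_sub_distrib, Finset.mul_sum]
  ring

theorem volume_le_det_mul_orthantVolume {n : ℕ} {K : Set (EuclideanSpace ℝ (Fin n))}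
    [CompactSpace K] {S : Affine.Simplex ℝ (EuclideanSpace ℝ (Fin n)) n}
    {P : C(K, ℝ) →L[ℝ] C(K, ℝ)} (hP : IsInterpolationProjector K S P) :
    volume K ≤ ENNReal.ofReal
      (|(edgeMatrix S.points).det| * orthantVolume n ((‖P‖ + 1) / 2) ((‖P‖ - 1) / 2)) := by
  have hP1 := one_le_norm_of_isInterpolationProjector hP
  have hK : MeasurableSet K := (isCompact_iff_compactSpace.2 ‹_›).measurableSet
  have hsub : (fun v : Fin n → ℝ => WithLp.ofLp (S.points 0) + v) ⁻¹' (WithLp.toLp 2 ⁻¹' K) ⊆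
      Matrix.toLin' (edgeMatrix S.points).transpose ''
        orthantSet n ((‖P‖ + 1) / 2) ((‖P‖ - 1) / 2) := by
    intro v hv
    refine ⟨_, coord_mem_orthantSet S (sum_abs_coord_le_norm hP ⟨_, hv⟩), ?_⟩
    ext j
    rw [Matrix.toLin'_apply, sub_eq_edgeMatrix_mulVec]
    simp
  calc volume K = volume (WithLp.toLp 2 ⁻¹' K) :=
        ((PiLp.volume_preserving_toLp (Fin n)).measure_preimage hK.nullMeasurableSet).symm
    _ = volume ((fun v : Fin n → ℝ => WithLp.ofLp (S.points 0) + v) ⁻¹'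
          (WithLp.toLp 2 ⁻¹' K)) := (measure_preimage_add _ _ _).symm
    _ ≤ _ := measure_mono hsub
    _ ≤ _ := by
      rw [Measure.addHaar_image_linearMap, LinearMap.det_toLin', Matrix.det_transpose,
        ENNReal.ofReal_mul (abs_nonneg _)]
      gcongr
      exact volume_orthantSet_le n (by linarith) (by linarith)

theorem ballRatio_le_chi_norm {n : ℕ} (hn : 1 ≤ n)
    {S : Affine.Simplex ℝ (EuclideanSpace ℝ (Fin n)) n}
    {P : C(unitBall n, ℝ) →L[ℝ] C(unitBall n, ℝ)} (hP : IsInterpolationProjector (unitBall n) S P) :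
    ballRatio n ≤ chi n ‖P‖ := by
  have hP1 := one_le_norm_of_isInterpolationProjector hP
  have hn0 : (0 : ℝ) < n := by exact_mod_cast hn
  have : Nonempty (Fin n) := ⟨⟨0, hn⟩⟩
  have hV := orthantVolume_nonneg n (by linarith : 0 ≤ (‖P‖ + 1) / 2)
    (by linarith : 0 ≤ (‖P‖ - 1) / 2)
  have h := volume_le_det_mul_orthantVolume hP
  rw [EuclideanSpace.volume_closedBall, Fintype.card_fin, ENNReal.ofReal_one, one_pow, one_mul,
    ENNReal.ofReal_le_ofReal_iff (by positivity)] at h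
  have hd := abs_det_edgeMatrix_le hn fun i => mem_closedBall_zero_iff.1 (hP.nodes_mem i)
  have h2 := h.trans (mul_le_mul_of_nonneg_right hd hV)
  have hG : 0 < Real.Gamma ((n : ℝ) / 2 + 1) := Real.Gamma_pos_of_pos (by positivity)
  rw [chi_eq_factorial_mul_orthantVolume, ballRatio, div_le_iff₀ (by positivity)]
  have hpi : Real.pi ^ ((n : ℝ) / 2) = √Real.pi ^ n := by
    rw [Real.sqrt_eq_rpow, ← Real.rpow_natCast, ← Real.rpow_mul Real.pi_pos.le]
    congr 1
    ring
  rw [div_le_iff₀ hG] at h2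
  rw [hpi]
  calc _ ≤ (√((n : ℝ) + 1) * (((n : ℝ) + 1) / n) ^ ((n : ℝ) / 2) *
          orthantVolume n ((‖P‖ + 1) / 2) ((‖P‖ - 1) / 2) * Real.Gamma ((n : ℝ) / 2 + 1)) *
          n.factorial := by gcongr
    _ = _ := by ring

/-! ### Existence of projectors. -/

theorem exists_isInterpolationProjector {n : ℕ} {K : Set (EuclideanSpace ℝ (Fin n))}
    [CompactSpace K] (S : Affine.Simplex ℝ (EuclideanSpace ℝ (Fin n)) n)
    (hS : ∀ i, S.points i ∈ K) : ∃ P, IsInterpolationProjector K S P := by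
  let l : Fin (n + 1) → C(K, ℝ) := fun i => ⟨fun y => (simplexBasis S).coord i y,
    (AffineMap.continuous_of_finiteDimensional _).comp continuous_subtype_val⟩
  let P : C(K, ℝ) →L[ℝ] C(K, ℝ) :=
    ∑ i, (ContinuousMap.evalCLM ℝ (⟨S.points i, hS i⟩ : K)).smulRight (l i)
  have hPf : ∀ f x, P f x = ∑ i, f ⟨S.points i, hS i⟩ * (simplexBasis S).coord i x := by
    intro f x
    simp [P, l, ContinuousMap.sum_apply]
  refine ⟨P, hS, fun f => ⟨∑ i, f ⟨S.points i, hS i⟩ • (simplexBasis S).coord i, fun x => ?_⟩,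
    fun f j => ?_⟩
  · let ev : (EuclideanSpace ℝ (Fin n) →ᵃ[ℝ] ℝ) →+ ℝ :=
      { toFun := fun g => g x, map_zero' := rfl, map_add' := fun _ _ => rfl }
    rw [hPf]
    exact (map_sum ev (fun i => f ⟨S.points i, hS i⟩ • (simplexBasis S).coord i)
      Finset.univ).symm
  · simp [hPf, simplexBasis_coord_points]

theorem exists_simplex_unitBall (n : ℕ) :
    ∃ S : Affine.Simplex ℝ (EuclideanSpace ℝ (Fin n)) n, ∀ i, S.points i ∈ unitBall n := by
  let x : Fin (n + 1) → EuclideanSpace ℝ (Fin n) :=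
    Fin.cons 0 (EuclideanSpace.basisFun (Fin n) ℝ)
  have hx : AffineIndependent ℝ x := by
    rw [affineIndependent_iff_linearIndependent_vsub ℝ x 0,
      ← linearIndependent_equiv (finSuccAboveEquiv (0 : Fin (n + 1)))]
    have h : ((fun i : {i : Fin (n + 1) // i ≠ 0} => x i -ᵥ x 0) ∘
        finSuccAboveEquiv (0 : Fin (n + 1))) = EuclideanSpace.basisFun (Fin n) ℝ := by
      funext i
      simp [x, finSuccAboveEquiv]
    rw [h]
    exact (EuclideanSpace.basisFun (Fin n) ℝ).orthonormal.linearIndependent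
  refine ⟨⟨x, hx⟩, fun i => mem_closedBall_zero_iff.2 ?_⟩
  refine Fin.cases ?_ (fun i => ?_) i <;> simp [x]

theorem le_theta {n : ℕ} {r : ℝ}
    (h : ∀ S P, IsInterpolationProjector (unitBall n) S P → r ≤ ‖P‖) :
    r ≤ theta n (unitBall n) := by
  -- Nonemptiness matters: the real `sInf` of the empty set is 0.
  obtain ⟨S, hS⟩ := exists_simplex_unitBall n
  obtain ⟨P, hP⟩ := exists_isInterpolationProjector S hS
  refine le_csInf ⟨_, S, P, hP, rfl⟩ ?_
  rintro _ ⟨S, P, hP, rfl⟩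
  exact h S P hP

/-! ### Explicit arguments and their lower bound 1. -/

theorem ballRatio_two_mul (k : ℕ) : ballRatio (2 * k) = ballRatioEven k := by
  have h1 : ((2 * k : ℕ) : ℝ) / 2 = k := by
    push_cast
    ring
  rw [ballRatio, ballRatioEven, h1, Real.Gamma_nat_eq_factorial, Real.rpow_natCast,
    Real.rpow_natCast]
  push_cast
  rfl

theorem ballRatio_two_mul_add_one (k : ℕ) : ballRatio (2 * k + 1) = ballRatioOdd k := by
  have h1 : ((2 * k + 1 : ℕ) : ℝ) / 2 = k + 1 / 2 := by
    push_cast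
    ring
  have h2 : ((2 * k + 1 : ℕ) : ℝ) + 1 = 2 * (k : ℝ) + 2 := by
    push_cast
    ring
  have h3 : Real.Gamma ((k : ℝ) + 1 / 2 + 1)
      = ((2 * k + 1).doubleFactorial : ℝ) * √Real.pi / 2 ^ (k + 1) := by
    have h := Real.Gamma_nat_add_half (k + 1)
    rw [show 2 * (k + 1) - 1 = 2 * k + 1 by omega] at h
    rw [← h]
    push_cast
    ring_nf
  have h4 : ((2 * k + 1).factorial : ℝ) = (2 * k + 1).doubleFactorial * (2 ^ k * k.factorial) := by
    rw [Nat.factorial_eq_mul_doubleFactorial, Nat.doubleFactorial_two_mul]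
    push_cast
    rfl
  have h5 : Real.pi ^ ((k : ℝ) + 1 / 2) = Real.pi ^ k * √Real.pi := by
    rw [Real.rpow_add Real.pi_pos, Real.rpow_natCast, Real.sqrt_eq_rpow]
  have h6 : ((2 * k + 1).doubleFactorial : ℝ) ≠ 0 := by
    exact_mod_cast (Nat.doubleFactorial_pos _).ne'
  have h7 : (0 : ℝ) < ((2 * (k : ℝ) + 2) / (2 * (k : ℝ) + 1)) ^ ((k : ℝ) + 1 / 2) := by positivity
  have h8 : (2 * (k : ℝ) + 1) / 2 = k + 1 / 2 := by ring
  rw [ballRatio, ballRatioOdd, h1, h2, h3, h4, h5, h8]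
  push_cast
  have h9 : √Real.pi ≠ 0 := by positivity
  have h10 : √(2 * (k : ℝ) + 2) ≠ 0 := by positivity
  rw [mul_pow, show (4 : ℝ) = 2 * 2 by norm_num, mul_pow]
  field_simp
  ring

/-- A crude bound from `(1 + 1/n) ^ n ≤ e < 4`, enough to place the arguments in `[1, ∞)`. -/
theorem sqrt_mul_rpow_le {n : ℕ} (hn : 1 ≤ n) :
    √((n : ℝ) + 1) * (((n : ℝ) + 1) / n) ^ ((n : ℝ) / 2) ≤ 2 * (n + 1) := by
  have hn0 : (0 : ℝ) < n := by exact_mod_cast hn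
  have h1 : (((n : ℝ) + 1) / n) ^ ((n : ℝ) / 2) ≤ 2 := by
    have h : (((n : ℝ) + 1) / n) ^ (n : ℝ) ≤ 4 := by
      rw [Real.rpow_natCast, add_div, div_self hn0.ne', one_div]
      exact Real.one_add_inv_pow_le_exp.trans (Real.exp_one_lt_three.le.trans (by norm_num))
    rw [div_eq_mul_one_div (n : ℝ), Real.rpow_mul (by positivity), ← Real.sqrt_eq_rpow]
    exact Real.sqrt_le_iff.2 ⟨by norm_num, h.trans (by norm_num)⟩
  have h2 : √((n : ℝ) + 1) ≤ n + 1 := Real.sqrt_le_iff.2 ⟨by positivity, by nlinarith⟩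
  calc _ ≤ ((n : ℝ) + 1) * 2 := by gcongr
    _ = _ := by ring

theorem one_le_ballRatioEven {k : ℕ} (hk : 1 ≤ k) : 1 ≤ ballRatioEven k := by
  have hk1 : (1 : ℝ) ≤ k := by exact_mod_cast hk
  have h := sqrt_mul_rpow_le (n := 2 * k) (by omega)
  have h1 : ((2 * k : ℕ) : ℝ) / 2 = k := by
    push_cast
    ring
  rw [h1, Real.rpow_natCast] at h
  push_cast at h
  have h2 : (k.factorial : ℝ) * 2 ^ k ≤ (2 * k).factorial := by
    have h3 : k.factorial * (k + 1) ^ k ≤ (k + k).factorial := Nat.factorial_mul_pow_le_factorial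
    rw [two_mul]
    refine le_trans ?_ (Nat.cast_le.2 h3)
    push_cast
    gcongr
    linarith
  have h4 : (3 : ℝ) ^ k ≤ Real.pi ^ k := by
    gcongr
    exact Real.pi_gt_three.le
  -- Bernoulli for `6 ^ k`; `1 + 5k ≥ 2(2k + 1)` holds as `k ≥ 1`.
  have h5 : 1 + (k : ℝ) * 5 ≤ 3 ^ k * 2 ^ k := by
    have := one_add_mul_le_pow (by norm_num : (-2 : ℝ) ≤ 5) k
    rw [← mul_pow]
    norm_num at this ⊢
    exact this
  rw [ballRatioEven, one_le_div (by positivity)]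
  calc _ = k.factorial * (√(2 * (k : ℝ) + 1) * ((2 * (k : ℝ) + 1) / (2 * (k : ℝ))) ^ k) := by ring
    _ ≤ k.factorial * (3 ^ k * 2 ^ k) := by
        refine mul_le_mul_of_nonneg_left ?_ (Nat.cast_nonneg _)
        linarith
    _ = 3 ^ k * (k.factorial * 2 ^ k) := by ring
    _ ≤ _ := by gcongr

theorem one_le_ballRatioOdd (k : ℕ) : 1 ≤ ballRatioOdd k := by
  -- For `k = 0` the ratio is exactly 1, so the crude bound cannot serve.
  rcases Nat.eq_zero_or_pos k with rfl | hk
  · have h : √(2 : ℝ) * 2 ^ (1 / 2 : ℝ) = 2 := by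
      rw [← Real.sqrt_eq_rpow, Real.mul_self_sqrt zero_le_two]
    simp only [ballRatioOdd, Nat.cast_zero, mul_zero, zero_add, div_one, h]
    norm_num
  have hk1 : (1 : ℝ) ≤ k := by exact_mod_cast hk
  have h := sqrt_mul_rpow_le (n := 2 * k + 1) (by omega)
  push_cast at h
  have h0 : 2 * (k : ℝ) + 1 + 1 = 2 * k + 2 := by ring
  rw [h0] at h
  have h4 : (8 : ℝ) ^ k ≤ (4 * Real.pi) ^ k := by
    gcongr
    linarith [Real.pi_gt_three]
  have h5 : 1 + (k : ℝ) * 7 ≤ 8 ^ k := by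
    have := one_add_mul_le_pow (by norm_num : (-2 : ℝ) ≤ 7) k
    norm_num at this ⊢
    exact this
  have h6 : (1 : ℝ) ≤ k.factorial := by exact_mod_cast Nat.factorial_pos k
  rw [ballRatioOdd, one_le_div (by positivity)]
  calc _ ≤ 2 * (2 * (k : ℝ) + 2) := h
    _ ≤ 2 * 1 * 8 ^ k := by linarith
    _ ≤ _ := by gcongr

theorem one_le_ballRatio {n : ℕ} (hn : 1 ≤ n) : 1 ≤ ballRatio n := by
  obtain ⟨k, rfl | rfl⟩ := Nat.even_or_odd' n
  · rw [ballRatio_two_mul]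
    exact one_le_ballRatioEven (by omega)
  · rw [ballRatio_two_mul_add_one]
    exact one_le_ballRatioOdd k

theorem chiInv_ballRatio_le_theta {n : ℕ} (hn : 1 ≤ n) :
    chiInv n (ballRatio n) ≤ theta n (unitBall n) :=
  le_theta fun _ _ hP => chiInv_le hn (one_le_ballRatio hn)
    (one_le_norm_of_isInterpolationProjector hP) (ballRatio_le_chi_norm hn hP)

/-- Besides the inequalities, each part records that the argument belongs to the range of `chi`
on `[1, ∞)`, so that the value of `chiInv` is the genuine one. -/
theorem mainTheorem6 :
    (∀ n : ℕ, 1 ≤ n →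
      ballRatio n ∈ chi n '' Set.Ici 1 ∧
      theta n (unitBall n) ≥ chiInv n (ballRatio n)) ∧
    (∀ k : ℕ, 1 ≤ k →
      ballRatioEven k ∈ chi (2 * k) '' Set.Ici 1 ∧
      (theta (2 * k) (unitBall (2 * k)) ≥ chiInv (2 * k) (ballRatio (2 * k)) ↔
        theta (2 * k) (unitBall (2 * k)) ≥ chiInv (2 * k) (ballRatioEven k)) ∧
      theta (2 * k) (unitBall (2 * k)) ≥ chiInv (2 * k) (ballRatioEven k)) ∧
    (∀ k : ℕ,
      ballRatioOdd k ∈ chi (2 * k + 1) '' Set.Ici 1 ∧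
      theta (2 * k + 1) (unitBall (2 * k + 1)) ≥ chiInv (2 * k + 1) (ballRatioOdd k)) := by
  have h : ∀ n : ℕ, 1 ≤ n → ballRatio n ∈ chi n '' Set.Ici 1 ∧
      theta n (unitBall n) ≥ chiInv n (ballRatio n) := fun n hn =>
    ⟨mem_chi_image hn (one_le_ballRatio hn), chiInv_ballRatio_le_theta hn⟩
  refine ⟨h, fun k hk => ?_, fun k => ?_⟩
  · obtain ⟨h1, h2⟩ := h (2 * k) (by omega)
    rw [ballRatio_two_mul] at h1 h2 ⊢
    exact ⟨h1, Iff.rfl, h2⟩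
  · rw [← ballRatio_two_mul_add_one]
    exact h (2 * k + 1) (by omega)
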